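/- Let $K$ be a field of characteristic $0$. All dependence on the times $x=(x_1,x_3,x_5,\dots)$, $y=(y_1,y_3,y_5,\dots)$ is through formal power series over $K$, matrices are indexed by $\mathbb Z\times\mathbb Z$, and all infinite sums are formal (finite in each coefficient). Put $\Lambda=(\delta_{j-i,1})$, $J=((-1)^i\delta_{i+j,0})$, $\varepsilon=\mathrm{diag}[s]\Lambda^{-1}$, $\varepsilon^*=-\varepsilon^T+\Lambda$, $\chi(z)=(z^j)_{j\in\mathbb Z}$, $\xi(x,\Lambda)=\sum_{n\ge0}x_{2n+1}\Lambda^{2n+1}$, $\xi(y,\Lambda^{-1})=\sum_{n\ge0}y_{2n+1}\Lambda^{-2n-1}$. For a matrix $P$ let $P_l$ be its strictly lower triangular part and $P_u$ its upper triangular part (with diagonal), and put $$(P_1,P_2)_+=(P_{1u}+P_{2l},\,P_{1u}+P_{2l}),\qquad (P_1,P_2)_-=(P_{1l}-P_{2l},\,P_{2u}-P_{1u}).$$ Let $W=(W_1,W_2)$ be wave operators of the BTL hierarchy: $W_1=S_1e^{\xi(x,\Lambda)}$, $W_2=S_2e^{\xi(y,\Lambda^{-1})}$ with $S_1$ lower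 unitriangular and $S_2$ upper triangular with invertible diagonal entries, such that, with $L_1=W_1\Lambda W_1^{-1}$ and $L_2=W_2\Lambda^{-1}W_2^{-1}$, $$J^{-1}W_i^TJ=W_i^{-1}\ (i=1,2),\qquad \partial_{x_{2n+1}}W=(L_1^{2n+1},0)_+W,\qquad \partial_{y_{2n+1}}W=(0,L_2^{2n+1})_+W\quad(n\ge0).$$ Let $M_1=W_1\varepsilon W_1^{-1}$, $M_2=W_2\varepsilon^*W_2^{-1}$, and for $m\ge0$, $l\in\mathbb Z$ let $A_{iml}=M_i^mL_i^l-(-1)^lL_i^{l-1}M_i^mL_i$. The additional symmetries are $$\partial_{x^*_{m,l}}W=-(A_{1ml},0)_-W,\qquad \partial_{y^*_{m,l}}W=-(0,A_{2ml})_-W .$$ A vector $q$ is an eigenfunction if $\partial_{x_{2n+1}}q=(L_1^{2n+1})_uq$ and $\partial_{y_{2n+1}}q=(L_2^{2n+1})_lq$ for all $n\ge0$. The squared eigenfunction symmetry generated by eigenfunctions $q_1,q_2$ is $$\partial_\alpha W_1=(q_1\otimes Jq_2-q_2\otimes Jq_1)_lW_1,\qquad \partial_\alpha W_2=-(q_1\otimes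 Jq_2-q_2\otimes Jq_1)_uW_2,$$ where $(a\otimes b)_{ij}=a_ib_j$. Let $\Psi_i(z)=W_i\chi(z)$ be the wave functions. Series in the spectral parameters $\lambda,\mu$ are formal series in nonnegative powers of $\mu-\lambda$ and integer powers of $\lambda$; powers $\mu^j$, $j\in\mathbb Z$, are expanded by the binomial series at $\mu=\lambda$. Then $\Psi_1(\mu)$, $\lambda^{-1}\Psi_1(-\lambda)$, $-\Psi_2(\mu^{-1})$ and $\lambda^{-1}\Psi_2(-\lambda^{-1})$ are eigenfunctions. Let $\partial_{\alpha_1}$ be the squared eigenfunction symmetry generated by $q_1=\Psi_1(\mu)$, $q_2=\lambda^{-1}\Psi_1(-\lambda)$, and $\partial_{\alpha_2}$ the one generated by $q_1=-\Psi_2(\mu^{-1})$, $q_2=\lambda^{-1}\Psi_2(-\lambda^{-1})$. All infinite sums in their definition converge formally, and $\partial_{\alpha_1}$, $\partial_{\alpha_2}$ are, up to the sign $-1$, the generating functions of the additional symmetries: as actions on $W_1$ and on $W_2$, $$\partial_{\alpha_1}=-\sum_{m=0}^\infty\frac{(\mu-\lambda)^m}{m!}\sum_{k=-\infty}^\infty\lambda^{-k-m-1}\,\partial_{x^*_{m,m+k}},\qquad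 \partial_{\alpha_2}=-\sum_{m=0}^\infty\frac{(\mu-\lambda)^m}{m!}\sum_{k=-\infty}^\infty\lambda^{-k-m-1}\,\partial_{y^*_{m,m+k}}.$$ -/

import Mathlib

/-!
The BTL (two-dimensional Toda lattice of type B) hierarchy over a field `K` of characteristic zero,
in the formal setting: every dependence on the times `x₁, x₃, x₅, …` and `y₁, y₃, y₅, …` is through
formal power series, and every infinite sum (in a product of `ℤ × ℤ` matrices, in an exponential,
in a product of bilateral series in a spectral parameter) is a formal sum, that is, a sum which is
finite in each coefficient.
-/

namespace BTL

/-! ### Functions of the times, and formal sums -/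

/-- Formal power series in the times. The variable `Sum.inl n` is `x_{2n+1}`, and `Sum.inr n` is
`y_{2n+1}`. -/
abbrev Fn (K : Type*) [Field K] : Type _ := MvPowerSeries (ℕ ⊕ ℕ) K

/-- A family of power series is formally summable if each monomial occurs in only finitely many of
its members. -/
def FormallySummable {K : Type*} [Field K] {ι : Type*} (f : ι → Fn K) : Prop :=
  ∀ d : (ℕ ⊕ ℕ) →₀ ℕ, {k : ι | MvPowerSeries.coeff d (f k) ≠ 0}.Finite

/-- The formal (coefficientwise) sum of a family of power series. -/
noncomputable def fsum {K : Type*} [Field K] {ι : Type*} (f : ι → Fn K) : Fn K :=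
  fun d => ∑ᶠ k, MvPowerSeries.coeff d (f k)

/-! ### Infinite matrices -/

/-- `ℤ × ℤ` matrices of power series in the times. -/
abbrev Mat (K : Type*) [Field K] : Type _ := Matrix ℤ ℤ (Fn K)

/-- The product of infinite matrices. -/
noncomputable def matMul {K : Type*} [Field K] (A B : Mat K) : Mat K :=
  fun i j => fsum fun k : ℤ => A i k * B k j

infixl:70 " ⋇ " => matMul

/-- The powers `A ^ n`, `n = 0, 1, 2, …`. -/
noncomputable def matPow {K : Type*} [Field K] (A : Mat K) : ℕ → Mat K
  | 0 => 1
  | n + 1 => matPow A n ⋇ A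

/-- The powers `A ^ l` with `l : ℤ` of a matrix `A` whose inverse is `B`. -/
noncomputable def matZPow {K : Type*} [Field K] (A B : Mat K) (l : ℤ) : Mat K :=
  if 0 ≤ l then matPow A l.toNat else matPow B (-l).toNat

/-- `exp A = ∑ₙ Aⁿ / n!`. -/
noncomputable def matExp {K : Type*} [Field K] (A : Mat K) : Mat K :=
  fun i j => fsum fun n : ℕ => ((n.factorial : K)⁻¹) • matPow A n i j

/-- The shift matrix `Λ ^ k = (δ_{j - i, k})`. -/
noncomputable def Lam (K : Type*) [Field K] (k : ℤ) : Mat K :=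
  fun i j => if j - i = k then 1 else 0

/-- `J = ((-1)^i δ_{i + j, 0})`. -/
noncomputable def J (K : Type*) [Field K] : Mat K :=
  fun i j => if i + j = 0 then MvPowerSeries.C ((-1 : K) ^ i) else 0

/-- `J⁻¹ = J`. -/
theorem J_mul_J (K : Type*) [Field K] : J K ⋇ J K = 1 := by
  funext i j
  have h : ∀ k : ℤ, k ≠ -i → J K i k * J K k j = 0 := by
    intro k hk
    have : i + k ≠ 0 := fun h => hk (by omega)
    simp [J, this]
  have h1 : (J K ⋇ J K) i j = J K i (-i) * J K (-i) j := by
    ext d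
    change (∑ᶠ k, MvPowerSeries.coeff d (J K i k * J K k j)) = _
    exact finsum_eq_single _ (-i) fun k hk => by rw [h k hk, map_zero]
  rw [h1]
  by_cases hij : i = j
  · subst hij
    have h2 : ((-1 : K) ^ i) * ((-1 : K) ^ (-i)) = 1 := by
      rw [zpow_neg]
      exact mul_inv_cancel₀ (zpow_ne_zero _ (by simp))
    simp only [J, add_neg_cancel, neg_add_cancel, if_true, Matrix.one_apply_eq]
    rw [← map_mul, h2, map_one]
  · have h2 : ¬ (-i + j = 0) := fun h => hij (by omega)
    simp [J, h2, hij]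

/-- `P_l`, the strictly lower triangular part. -/
def lowerPart {α : Type*} [Zero α] (P : Matrix ℤ ℤ α) : Matrix ℤ ℤ α :=
  fun i j => if j < i then P i j else 0

/-- `P_u`, the upper triangular part (including the diagonal). -/
def upperPart {α : Type*} [Zero α] (P : Matrix ℤ ℤ α) : Matrix ℤ ℤ α :=
  fun i j => if i ≤ j then P i j else 0

/-- The product of pairs, `(P₁, P₂)(Q₁, Q₂) = (P₁Q₁, P₂Q₂)`. -/
noncomputable def pairMul {K : Type*} [Field K] (P Q : Mat K × Mat K) : Mat K × Mat K :=
  (P.1 ⋇ Q.1, P.2 ⋇ Q.2)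

/-- `(P₁, P₂)₊ = (P₁ᵤ + P₂ₗ, P₁ᵤ + P₂ₗ)`. -/
noncomputable def plusPart {K : Type*} [Field K] (P : Mat K × Mat K) : Mat K × Mat K :=
  (upperPart P.1 + lowerPart P.2, upperPart P.1 + lowerPart P.2)

/-- `(P₁, P₂)₋ = (P₁ₗ - P₂ₗ, P₂ᵤ - P₁ᵤ)`. -/
noncomputable def minusPart {K : Type*} [Field K] (P : Mat K × Mat K) : Mat K × Mat K :=
  (lowerPart P.1 - lowerPart P.2, upperPart P.2 - upperPart P.1)

/-- The entrywise derivative of a matrix with respect to a time. -/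
noncomputable def matDeriv {K : Type*} [Field K] (t : ℕ ⊕ ℕ) (A : Mat K) : Mat K :=
  fun i j => MvPowerSeries.pderiv K t (A i j)

/-! ### Wave operators, Lax operators and Orlov-Shulman operators -/

/-- `ξ(x, Λ) = ∑ₙ x_{2n+1} Λ^{2n+1}`. -/
noncomputable def xiX (K : Type*) [Field K] : Mat K :=
  fun i j => fsum fun n : ℕ =>
    (MvPowerSeries.X (Sum.inl n) : Fn K) * Lam K (2 * (n : ℤ) + 1) i j

/-- `ξ(y, Λ⁻¹) = ∑ₙ y_{2n+1} Λ^{-(2n+1)}`. -/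
noncomputable def xiY (K : Type*) [Field K] : Mat K :=
  fun i j => fsum fun n : ℕ =>
    (MvPowerSeries.X (Sum.inr n) : Fn K) * Lam K (-(2 * (n : ℤ) + 1)) i j

/-- A pair `S = (S₁, S₂)`, where `S₁ = ∑_{i ≥ 0} diag[c_i(s)] Λ^{-i}` with `c₀ = 1` and
`S₂ = ∑_{i ≥ 0} diag[c'_i(s)] Λ^i` with `c'₀(s)` invertible (nowhere zero), together with its
inverse. Such a pair has exactly one triangular inverse. -/
structure DressingPair (K : Type*) [Field K] where
  S₁ : Mat K
  S₁inv : Mat K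
  S₂ : Mat K
  S₂inv : Mat K
  S₁_lower : ∀ i j : ℤ, i < j → S₁ i j = 0
  S₁_diag : ∀ i : ℤ, S₁ i i = 1
  S₁inv_lower : ∀ i j : ℤ, i < j → S₁inv i j = 0
  S₁_mul_inv : S₁ ⋇ S₁inv = 1
  S₁_inv_mul : S₁inv ⋇ S₁ = 1
  S₂_upper : ∀ i j : ℤ, j < i → S₂ i j = 0
  S₂_diag : ∀ i : ℤ, IsUnit (S₂ i i)
  S₂inv_upper : ∀ i j : ℤ, j < i → S₂inv i j = 0
  S₂_mul_inv : S₂ ⋇ S₂inv = 1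
  S₂_inv_mul : S₂inv ⋇ S₂ = 1

namespace DressingPair

variable {K : Type*} [Field K] (D : DressingPair K)

/-- `W₁ = S₁ exp(ξ(x, Λ))`. -/
noncomputable def W₁ : Mat K := D.S₁ ⋇ matExp (xiX K)

/-- `W₁⁻¹ = exp(-ξ(x, Λ)) S₁⁻¹`. -/
noncomputable def W₁inv : Mat K := matExp (-xiX K) ⋇ D.S₁inv

/-- `W₂ = S₂ exp(ξ(y, Λ⁻¹))`. -/
noncomputable def W₂ : Mat K := D.S₂ ⋇ matExp (xiY K)

/-- `W₂⁻¹ = exp(-ξ(y, Λ⁻¹)) S₂⁻¹`. -/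
noncomputable def W₂inv : Mat K := matExp (-xiY K) ⋇ D.S₂inv

/-- `W = (W₁, W₂)`. -/
noncomputable def W : Mat K × Mat K := (D.W₁, D.W₂)

/-- `L₁ ^ l`, `l : ℤ`, where `L₁ = W₁ Λ W₁⁻¹`. -/
noncomputable def L₁pow (l : ℤ) : Mat K :=
  matZPow (D.W₁ ⋇ Lam K 1 ⋇ D.W₁inv) (D.W₁ ⋇ Lam K (-1) ⋇ D.W₁inv) l

/-- `L₂ ^ l`, `l : ℤ`, where `L₂ = W₂ Λ⁻¹ W₂⁻¹`. -/
noncomputable def L₂pow (l : ℤ) : Mat K :=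
  matZPow (D.W₂ ⋇ Lam K (-1) ⋇ D.W₂inv) (D.W₂ ⋇ Lam K 1 ⋇ D.W₂inv) l

/-- `D` gives wave operators of the BTL hierarchy: `W` satisfies the BTL constraint
`J⁻¹ Wᵢᵀ J = Wᵢ⁻¹` and evolves by `∂W/∂x_{2n+1} = (L₁^{2n+1}, 0)₊ W` and
`∂W/∂y_{2n+1} = (0, L₂^{2n+1})₊ W`. -/
structure IsBTL : Prop where
  constraint₁ : J K ⋇ D.W₁.transpose ⋇ J K = D.W₁inv
  constraint₂ : J K ⋇ D.W₂.transpose ⋇ J K = D.W₂inv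
  evolution_x : ∀ n : ℕ,
    (matDeriv (Sum.inl n) D.W₁, matDeriv (Sum.inl n) D.W₂) =
      pairMul (plusPart (D.L₁pow (2 * (n : ℤ) + 1), 0)) D.W
  evolution_y : ∀ n : ℕ,
    (matDeriv (Sum.inr n) D.W₁, matDeriv (Sum.inr n) D.W₂) =
      pairMul (plusPart (0, D.L₂pow (2 * (n : ℤ) + 1))) D.W

end DressingPair

/-- `ε = diag[s] Λ⁻¹`. -/
noncomputable def eps (K : Type*) [Field K] : Mat K :=
  fun i j => if j - i = -1 then (i : Fn K) else 0

/-- `ε* = -εᵀ + Λ`. -/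
noncomputable def epsStar (K : Type*) [Field K] : Mat K := -(eps K).transpose + Lam K 1

namespace DressingPair

variable {K : Type*} [Field K] (D : DressingPair K)

/-- The Orlov-Shulman operator `M₁ = W₁ ε W₁⁻¹`. -/
noncomputable def M₁ : Mat K := D.W₁ ⋇ eps K ⋇ D.W₁inv

/-- The Orlov-Shulman operator `M₂ = W₂ ε* W₂⁻¹`. -/
noncomputable def M₂ : Mat K := D.W₂ ⋇ epsStar K ⋇ D.W₂inv

/-! ### Additional symmetries -/

/-- `A_{1ml} = M₁^m L₁^l - (-1)^l L₁^{l-1} M₁^m L₁`. -/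
noncomputable def A₁ (m : ℕ) (l : ℤ) : Mat K :=
  matPow D.M₁ m ⋇ D.L₁pow l - ((-1 : K) ^ l) • (D.L₁pow (l - 1) ⋇ matPow D.M₁ m ⋇ D.L₁pow 1)

/-- `A_{2ml} = M₂^m L₂^l - (-1)^l L₂^{l-1} M₂^m L₂`. -/
noncomputable def A₂ (m : ℕ) (l : ℤ) : Mat K :=
  matPow D.M₂ m ⋇ D.L₂pow l - ((-1 : K) ^ l) • (D.L₂pow (l - 1) ⋇ matPow D.M₂ m ⋇ D.L₂pow 1)

/-- The additional symmetry `∂W/∂x*_{m,l} = -(A_{1ml}, 0)₋ W`. -/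
noncomputable def addFlowX (m : ℕ) (l : ℤ) : Mat K × Mat K :=
  pairMul (-minusPart (D.A₁ m l, 0)) D.W

/-- The additional symmetry `∂W/∂y*_{m,l} = -(0, A_{2ml})₋ W`. -/
noncomputable def addFlowY (m : ℕ) (l : ℤ) : Mat K × Mat K :=
  pairMul (-minusPart (0, D.A₂ m l)) D.W

end DressingPair

/-! ### Series in the spectral parameters -/

/-- Formal series `∑_{m ≥ 0} ∑_{n : ℤ} a m n (μ - λ)^m λ^n` with coefficients that are power series
in the times. -/
abbrev Ser (K : Type*) [Field K] : Type _ := ℕ → ℤ → Fn K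

namespace Ser

/-- `r (μ - λ)^m λ^n`. -/
def monomial {K : Type*} [Field K] (m : ℕ) (n : ℤ) (r : Fn K) : Ser K :=
  fun m' n' => if m' = m ∧ n' = n then r else 0

/-- The family of series is formally summable, with sum `a`: each coefficient of
`(μ - λ)^m λ^n` times a monomial in the times is a finite sum. -/
def HasFormalSum {K : Type*} [Field K] {ι : Type*} (f : ι → Ser K) (a : Ser K) : Prop :=
  ∀ (m : ℕ) (n : ℤ), FormallySummable (fun k => f k m n) ∧ fsum (fun k => f k m n) = a m n

/-- The bilateral sum that defines the product of `a` and `b` converges formally. -/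
def MulConverges {K : Type*} [Field K] (a b : Ser K) : Prop :=
  ∀ (m : ℕ) (n : ℤ), FormallySummable fun p : ℤ =>
    ∑ e ∈ Finset.HasAntidiagonal.antidiagonal m, a e.1 p * b e.2 (n - p)

/-- The product of series. -/
noncomputable def mul {K : Type*} [Field K] (a b : Ser K) : Ser K :=
  fun m n => fsum fun p : ℤ => ∑ e ∈ Finset.HasAntidiagonal.antidiagonal m, a e.1 p * b e.2 (n - p)

/-- `μ ^ j`, `j : ℤ`, expanded at `μ = λ`: the coefficient of `(μ - λ)^m λ^{j - m}` is the binomial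
coefficient `j(j-1)⋯(j-m+1)/m!`. -/
noncomputable def muPow (K : Type*) [Field K] (j : ℤ) : Ser K :=
  fun m n => if n = j - m then ((Ring.choose j m : ℤ) : Fn K) else 0

/-- `(-λ) ^ j`, `j : ℤ`. -/
noncomputable def negLamPow (K : Type*) [Field K] (j : ℤ) : Ser K :=
  monomial 0 j (MvPowerSeries.C ((-1 : K) ^ j))

/-- `λ⁻¹ a`. -/
noncomputable def lamInv {K : Type*} [Field K] (a : Ser K) : Ser K :=
  mul (monomial 0 (-1) 1) a

end Ser

/-- Vectors, indexed by `ℤ`, of series. -/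
abbrev Vec (K : Type*) [Field K] : Type _ := ℤ → Ser K

/-- The action of a matrix on a vector. -/
noncomputable def matVec {K : Type*} [Field K] (A : Mat K) (q : Vec K) : Vec K :=
  fun i m n => fsum fun k : ℤ => A i k * q k m n

/-- The product of a matrix of series with a matrix that does not depend on the spectral
parameters. -/
noncomputable def serMatMul {K : Type*} [Field K] (Y : Matrix ℤ ℤ (Ser K)) (B : Mat K) :
    Matrix ℤ ℤ (Ser K) :=
  fun i j m n => fsum fun k : ℤ => Y i k m n * B k j

/-- The sums that define `serMatMul Y B` converge formally. -/
def SerMatMulConverges {K : Type*} [Field K] (Y : Matrix ℤ ℤ (Ser K)) (B : Mat K) : Prop :=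
  ∀ (i j : ℤ) (m : ℕ) (n : ℤ), FormallySummable fun k : ℤ => Y i k m n * B k j

/-- `(a ⊗ b)_{ij} = a_i b_j`. -/
noncomputable def tensor {K : Type*} [Field K] (a b : Vec K) : Matrix ℤ ℤ (Ser K) :=
  fun i j => Ser.mul (a i) (b j)

namespace DressingPair

variable {K : Type*} [Field K] (D : DressingPair K)

/-! ### Wave functions and the squared eigenfunction flow -/

/-- `Ψ₁(μ) = W₁ χ(μ)`, where `χ(z) = (z^j)_j`. -/
noncomputable def Psi₁Mu : Vec K := matVec D.W₁ (Ser.muPow K)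

/-- `Ψ₁(-λ) = W₁ χ(-λ)`. -/
noncomputable def Psi₁NegLam : Vec K := matVec D.W₁ (Ser.negLamPow K)

/-- `Ψ₂(μ⁻¹) = W₂ χ(μ⁻¹)`. -/
noncomputable def Psi₂MuInv : Vec K := matVec D.W₂ fun j => Ser.muPow K (-j)

/-- `Ψ₂(-λ⁻¹) = W₂ χ(-λ⁻¹)`. -/
noncomputable def Psi₂NegLamInv : Vec K := matVec D.W₂ fun j => Ser.negLamPow K (-j)

/-- `q` is a vector eigenfunction: `∂q/∂x_{2n+1} = (L₁^{2n+1})ᵤ q` and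
`∂q/∂y_{2n+1} = (L₂^{2n+1})ₗ q`. -/
def IsEigenfunction (q : Vec K) : Prop :=
  (∀ (n : ℕ) (i : ℤ) (m : ℕ) (r : ℤ), MvPowerSeries.pderiv K (Sum.inl n) (q i m r) =
    matVec (upperPart (D.L₁pow (2 * (n : ℤ) + 1))) q i m r) ∧
  (∀ (n : ℕ) (i : ℤ) (m : ℕ) (r : ℤ), MvPowerSeries.pderiv K (Sum.inr n) (q i m r) =
    matVec (lowerPart (D.L₂pow (2 * (n : ℤ) + 1))) q i m r)

end DressingPair

/-- `q₁ ⊗ J q₂ - q₂ ⊗ J q₁`. -/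
noncomputable def sqEigMatrix {K : Type*} [Field K] (q₁ q₂ : Vec K) : Matrix ℤ ℤ (Ser K) :=
  tensor q₁ (matVec (J K) q₂) - tensor q₂ (matVec (J K) q₁)

namespace DressingPair

variable {K : Type*} [Field K] (D : DressingPair K)

/-- The squared eigenfunction flow generated by `q₁` and `q₂`:
`∂W₁ = (q₁ ⊗ J q₂ - q₂ ⊗ J q₁)ₗ W₁` and `∂W₂ = -(q₁ ⊗ J q₂ - q₂ ⊗ J q₁)ᵤ W₂`. -/
noncomputable def sqEigFlow (q₁ q₂ : Vec K) : Matrix ℤ ℤ (Ser K) × Matrix ℤ ℤ (Ser K) :=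
  (serMatMul (lowerPart (sqEigMatrix q₁ q₂)) D.W₁,
    -serMatMul (upperPart (sqEigMatrix q₁ q₂)) D.W₂)

/-- `q₁` and `q₂` are eigenfunctions, and all infinite sums in the definition of the squared
eigenfunction flow that they generate converge formally. -/
structure GeneratesSqEigFlow (q₁ q₂ : Vec K) : Prop where
  eigenfunction₁ : D.IsEigenfunction q₁
  eigenfunction₂ : D.IsEigenfunction q₂
  tensor₁ : ∀ i j : ℤ, Ser.MulConverges (q₁ i) (matVec (J K) q₂ j)
  tensor₂ : ∀ i j : ℤ, Ser.MulConverges (q₂ i) (matVec (J K) q₁ j)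
  flow₁ : SerMatMulConverges (lowerPart (sqEigMatrix q₁ q₂)) D.W₁
  flow₂ : SerMatMulConverges (upperPart (sqEigMatrix q₁ q₂)) D.W₂

end DressingPair

/-- The `(i, j)` entry of the term
`(μ - λ)^m / m! · λ^{-k-m-1} · F m (m + k)` of a double expansion; the index is `p = (m, k)`. -/
noncomputable def expansionTerm {K : Type*} [Field K] (F : ℕ → ℤ → Mat K) (i j : ℤ)
    (p : ℕ × ℤ) : Ser K :=
  Ser.monomial p.1 (-p.2 - p.1 - 1) (((p.1.factorial : K)⁻¹) • F p.1 (p.1 + p.2) i j)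

/-- `Y = -∑_{m ≥ 0} (μ - λ)^m / m! ∑_{k : ℤ} λ^{-k-m-1} F m (m + k)`, entry by entry. -/
def IsNegExpansion {K : Type*} [Field K] (F : ℕ → ℤ → Mat K) (Y : Matrix ℤ ℤ (Ser K)) : Prop :=
  ∀ i j : ℤ, Ser.HasFormalSum (fun p : ℕ × ℤ => -expansionTerm F i j p) (Y i j)

end BTL

namespace BTL

open MvPowerSeries

/-! ### Formal sums -/

section Sums

variable {K : Type*} [Field K] {ι κ : Type*}

theorem coeff_fsum (f : ι → Fn K) (d : (ℕ ⊕ ℕ) →₀ ℕ) :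
    coeff d (fsum f) = ∑ᶠ k, coeff d (f k) := rfl

theorem exists_coeff_ne_zero_of_fsum {f : ι → Fn K} {d : (ℕ ⊕ ℕ) →₀ ℕ}
    (h : coeff d (fsum f) ≠ 0) : ∃ k, coeff d (f k) ≠ 0 := by
  by_contra! h0
  exact h (by rw [coeff_fsum, finsum_congr h0, finsum_zero])

theorem fsum_eq_sum {f : ι → Fn K} (s : Finset ι) (h : ∀ k, k ∉ s → f k = 0) :
    fsum f = ∑ k ∈ s, f k := by
  ext d
  rw [coeff_fsum, map_sum]
  refine finsum_eq_sum_of_support_subset _ fun k hk => ?_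
  by_contra hks
  exact hk (by simp [h k hks])

theorem fsum_eq_single {f : ι → Fn K} (a : ι) (h : ∀ k, k ≠ a → f k = 0) : fsum f = f a := by
  rw [fsum_eq_sum {a} fun k hk => h k (by simpa using hk), Finset.sum_singleton]

theorem fsum_comp_equiv (e : ι ≃ κ) (f : κ → Fn K) : fsum (fun k => f (e k)) = fsum f := by
  ext d
  exact finsum_comp_equiv e (f := fun k => coeff d (f k))

theorem fsum_smul (c : K) (f : ι → Fn K) : fsum (fun k => c • f k) = c • fsum f := by
  ext d
  simp only [coeff_fsum, coeff_smul, smul_finsum, ← smul_eq_mul]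

theorem fsum_neg (f : ι → Fn K) : fsum (fun k => -f k) = -fsum f := by
  ext d
  simp only [coeff_fsum, map_neg, finsum_neg_distrib]

theorem FormallySummable.comp_equiv {f : κ → Fn K} (hf : FormallySummable f) (e : ι ≃ κ) :
    FormallySummable fun k => f (e k) := fun d =>
  (hf d).preimage (e.injective.injOn)

theorem FormallySummable.smul {f : ι → Fn K} (hf : FormallySummable f) (c : ι → K) :
    FormallySummable fun k => c k • f k := fun d =>
  (hf d).subset fun k hk h => hk (by rw [coeff_smul, h, mul_zero])

theorem FormallySummable.neg {f : ι → Fn K} (hf : FormallySummable f) :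
    FormallySummable fun k => -f k := fun d =>
  (hf d).subset fun k hk h => hk (by rw [map_neg, h, neg_zero])

theorem mul_fsum (g : Fn K) {f : ι → Fn K} (hf : FormallySummable f) :
    g * fsum f = fsum fun k => g * f k := by
  ext d
  simp only [coeff_fsum, coeff_mul]
  rw [finsum_sum_comm]
  · refine Finset.sum_congr rfl fun e _ => ?_
    rw [mul_finsum]
  · exact fun e _ => (hf e.2).subset fun k hk h => hk (by
      change _ * _ = _
      rw [h, mul_zero])

theorem fsum_mul {f : ι → Fn K} (hf : FormallySummable f) (g : Fn K) :
    fsum f * g = fsum fun k => f k * g := by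
  simp only [mul_comm _ g, mul_fsum g hf]

theorem fsum_comm {f : ι → κ → Fn K}
    (hf : ∀ d, {p : ι × κ | coeff d (f p.1 p.2) ≠ 0}.Finite) :
    (fsum fun i => fsum fun j => f i j) = fsum fun j => fsum fun i => f i j := by
  ext d
  simp only [coeff_fsum]
  have h1 := finsum_curry (fun p : ι × κ => coeff d (f p.1 p.2)) (hf d)
  have h2 := finsum_curry (fun p : κ × ι => coeff d (f p.2 p.1))
    ((hf d).preimage (f := Prod.swap) Prod.swap_injective.injOn)
  rw [← h1, ← h2]
  exact (finsum_comp_equiv (Equiv.prodComm κ ι) (f := fun p : ι × κ => coeff d (f p.1 p.2))).symm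

theorem exists_coeff_ne_zero_of_mul {f g : Fn K} {d : (ℕ ⊕ ℕ) →₀ ℕ} (h : coeff d (f * g) ≠ 0) :
    ∃ a b, a + b = d ∧ coeff a f ≠ 0 ∧ coeff b g ≠ 0 := by
  rw [coeff_mul] at h
  obtain ⟨e, he, hne⟩ := Finset.exists_ne_zero_of_sum_ne_zero h
  exact ⟨e.1, e.2, Finset.HasAntidiagonal.mem_antidiagonal.1 he, left_ne_zero_of_mul hne,
    right_ne_zero_of_mul hne⟩

end Sums

/-! ### Matrices whose entries far from the diagonal on one side have large weight -/

section Tame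

variable {K : Type*} [Field K] {σ : ℤ} {w : ℕ ⊕ ℕ → ℕ} {a b c : ℤ} {A B C : Mat K}

/-- Every monomial of the entry `A i j` has weight at least `σ (j - i) - c`. -/
def Tame (σ : ℤ) (w : ℕ ⊕ ℕ → ℕ) (c : ℤ) (A : Mat K) : Prop :=
  ∀ (i j : ℤ) (d : (ℕ ⊕ ℕ) →₀ ℕ), coeff d (A i j) ≠ 0 → σ * (j - i) ≤ Finsupp.weight w d + c

theorem Tame.matMul (hA : Tame σ w a A) (hB : Tame σ w b B) : Tame σ w (a + b) (A ⋇ B) := by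
  intro i j d h
  obtain ⟨k, hk⟩ := exists_coeff_ne_zero_of_fsum h
  obtain ⟨d₁, d₂, rfl, h₁, h₂⟩ := exists_coeff_ne_zero_of_mul hk
  have := hA _ _ _ h₁
  have := hB _ _ _ h₂
  rw [map_add]
  push_cast
  linarith

theorem Tame.summable (hσ : σ = 1 ∨ σ = -1) (hA : Tame σ w a A) (hB : Tame σ w b B) (i j : ℤ) :
    FormallySummable fun k => A i k * B k j := by
  intro d
  refine (Set.finite_Icc (-(|i| + |j| + |a| + |b| + Finsupp.weight w d))
    (|i| + |j| + |a| + |b| + Finsupp.weight w d)).subset fun k hk => ?_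
  obtain ⟨d₁, d₂, rfl, h₁, h₂⟩ := exists_coeff_ne_zero_of_mul hk
  have := hA _ _ _ h₁
  have := hB _ _ _ h₂
  rw [map_add]
  push_cast
  rw [Set.mem_Icc]
  rcases hσ with rfl | rfl <;> constructor <;>
    linarith [le_abs_self i, le_abs_self j, le_abs_self a, le_abs_self b, neg_abs_le i,
      neg_abs_le j, neg_abs_le a, neg_abs_le b]

theorem Tame.matMul_assoc (hσ : σ = 1 ∨ σ = -1) (hA : Tame σ w a A) (hB : Tame σ w b B)
    (hC : Tame σ w c C) : A ⋇ B ⋇ C = A ⋇ (B ⋇ C) := by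
  funext i j
  have h1 : (A ⋇ B ⋇ C) i j = fsum fun l => fsum fun k => A i k * B k l * C l j :=
    congrArg fsum (funext fun l => fsum_mul (hA.summable hσ hB i l) (C l j))
  have h2 : (A ⋇ (B ⋇ C)) i j = fsum fun k => fsum fun l => A i k * B k l * C l j :=
    congrArg fsum (funext fun k => (mul_fsum (A i k) (hB.summable hσ hC k j)).trans
      (by simp only [mul_assoc]))
  rw [h1, h2]
  refine fsum_comm fun d => ?_
  set N : ℤ := |i| + |j| + |a| + |b| + |c| + Finsupp.weight w d with hN
  refine ((Set.finite_Icc (-N) N).prod (Set.finite_Icc (-N) N)).subset ?_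
  rintro ⟨l, k⟩ hk
  obtain ⟨d', d₃, hd, h', h₃⟩ := exists_coeff_ne_zero_of_mul hk
  obtain ⟨d₁, d₂, rfl, h₁, h₂⟩ := exists_coeff_ne_zero_of_mul h'
  have := hA _ _ _ h₁
  have := hB _ _ _ h₂
  have := hC _ _ _ h₃
  rw [← hd, map_add, map_add] at hN
  push_cast at hN
  rw [Set.mem_prod, Set.mem_Icc, Set.mem_Icc, hN]
  rcases hσ with rfl | rfl <;> refine ⟨⟨?_, ?_⟩, ?_, ?_⟩ <;>
    linarith [le_abs_self i, le_abs_self j, le_abs_self a, le_abs_self b, le_abs_self c,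
      neg_abs_le i, neg_abs_le j, neg_abs_le a, neg_abs_le b, neg_abs_le c]

theorem tame_of_lower (h : ∀ i j : ℤ, i < j → A i j = 0) : Tame 1 w 0 A := by
  intro i j d hd
  by_contra hlt
  refine hd ?_
  rw [h i j (by linarith [Int.natCast_nonneg (Finsupp.weight w d)]), map_zero]

theorem tame_of_upper (h : ∀ i j : ℤ, j < i → A i j = 0) : Tame (-1) w 0 A := by
  intro i j d hd
  by_contra hlt
  refine hd ?_
  rw [h i j (by linarith [Int.natCast_nonneg (Finsupp.weight w d)]), map_zero]

theorem matMul_one (A : Mat K) : A ⋇ 1 = A := by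
  funext i j
  refine (fsum_eq_single j fun k hk => ?_).trans ?_
  · rw [Matrix.one_apply_ne hk, mul_zero]
  · rw [Matrix.one_apply_eq, mul_one]

theorem one_matMul (A : Mat K) : 1 ⋇ A = A := by
  funext i j
  refine (fsum_eq_single i fun k hk => ?_).trans ?_
  · rw [Matrix.one_apply_ne (Ne.symm hk), zero_mul]
  · rw [Matrix.one_apply_eq, one_mul]

theorem tame_one (σ : ℤ) (w : ℕ ⊕ ℕ → ℕ) : Tame σ w 0 (1 : Mat K) := by
  intro i j d h
  have : i = j := by
    by_contra hij
    exact h (by rw [Matrix.one_apply_ne hij, map_zero])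
  subst this
  simp

theorem Tame.matPow (hA : Tame σ w 0 A) (n : ℕ) : Tame σ w 0 (matPow A n) := by
  induction n with
  | zero => exact tame_one σ w
  | succ n ih => exact ih.matMul hA

theorem Tame.matExp (hA : Tame σ w 0 A) : Tame σ w 0 (matExp A) := by
  intro i j d h
  obtain ⟨n, hn⟩ := exists_coeff_ne_zero_of_fsum h
  rw [coeff_smul] at hn
  exact hA.matPow n i j d (right_ne_zero_of_mul hn)

theorem Tame.neg (hA : Tame σ w a A) : Tame σ w a (-A) := fun i j d h =>
  hA i j d fun h0 => h (by rw [Matrix.neg_apply, map_neg, h0, neg_zero])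

theorem neg_matMul (A B : Mat K) : (-A) ⋇ B = -(A ⋇ B) := by
  funext i j
  exact (congrArg fsum (funext fun k => neg_mul (A i k) (B k j))).trans (fsum_neg _)

end Tame

/-! ### Conjugation -/

section Conj

variable {K : Type*} [Field K] {σ : ℤ} {w : ℕ ⊕ ℕ → ℕ} {V V' A B : Mat K} {a b : ℤ}

theorem conj_matMul_conj (hσ : σ = 1 ∨ σ = -1) (hV : Tame σ w 0 V) (hV' : Tame σ w 0 V')
    (hV'V : V' ⋇ V = 1) (hA : Tame σ w a A) (hB : Tame σ w b B) :
    (V ⋇ A ⋇ V') ⋇ (V ⋇ B ⋇ V') = V ⋇ (A ⋇ B) ⋇ V' := by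
  rw [Tame.matMul_assoc hσ (hV.matMul hA) hV' ((hV.matMul hB).matMul hV'),
    ← Tame.matMul_assoc hσ hV' (hV.matMul hB) hV', ← Tame.matMul_assoc hσ hV' hV hB, hV'V,
    one_matMul, ← Tame.matMul_assoc hσ (hV.matMul hA) hB hV', Tame.matMul_assoc hσ hV hA hB]

theorem Tame.exists_matPow (hA : Tame σ w a A) (n : ℕ) : ∃ c, Tame σ w c (BTL.matPow A n) := by
  induction n with
  | zero => exact ⟨0, tame_one σ w⟩
  | succ n ih => exact ⟨ih.choose + a, ih.choose_spec.matMul hA⟩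

theorem matPow_conj (hσ : σ = 1 ∨ σ = -1) (hV : Tame σ w 0 V) (hV' : Tame σ w 0 V')
    (hVV' : V ⋇ V' = 1) (hV'V : V' ⋇ V = 1) (hA : Tame σ w a A) (n : ℕ) :
    matPow (V ⋇ A ⋇ V') n = V ⋇ matPow A n ⋇ V' := by
  induction n with
  | zero => rw [matPow, matPow, matMul_one, hVV']
  | succ n ih =>
    obtain ⟨c, hc⟩ := hA.exists_matPow n
    rw [matPow, ih, conj_matMul_conj hσ hV hV' hV'V hc hA, matPow]

end Conj

/-! ### Matrices with one nonzero diagonal -/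

section ShiftDiag

variable {K : Type*} [Field K]

/-- `diag[e(i)] Λ^s`. -/
noncomputable def shiftDiag (e : ℤ → K) (s : ℤ) : Mat K :=
  fun i j => if j - i = s then C (e i) else 0

theorem tame_shiftDiag (σ : ℤ) (w : ℕ ⊕ ℕ → ℕ) (e : ℤ → K) (s : ℤ) :
    Tame σ w (σ * s) (shiftDiag e s) := by
  intro i j d h
  have : j - i = s := by
    by_contra hs
    exact h (by rw [shiftDiag, if_neg hs, map_zero])
  rw [this]
  linarith [Int.natCast_nonneg (Finsupp.weight w d)]

theorem matMul_shiftDiag_apply (A : Mat K) (e : ℤ → K) (s i j : ℤ) :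
    (A ⋇ shiftDiag e s) i j = e (j - s) • A i (j - s) := by
  refine (fsum_eq_single (j - s) fun k hk => ?_).trans ?_
  · rw [shiftDiag, if_neg (by omega), mul_zero]
  · rw [shiftDiag, if_pos (by omega), mul_comm, smul_eq_C_mul]

theorem shiftDiag_matMul_shiftDiag (e f : ℤ → K) (s t : ℤ) :
    shiftDiag e s ⋇ shiftDiag f t = shiftDiag (fun i => e i * f (i + s)) (s + t) := by
  funext i j
  rw [matMul_shiftDiag_apply, shiftDiag, shiftDiag]
  by_cases h : j - i = s + t
  · rw [if_pos (by omega), if_pos h, smul_eq_C_mul, ← map_mul, mul_comm,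
      show j - t = i + s by omega]
  · rw [if_neg (by omega), if_neg h, smul_zero]

theorem conj_shiftDiag_apply (V V' : Mat K) (e : ℤ → K) (s i j : ℤ) :
    (V ⋇ shiftDiag e s ⋇ V') i j = fsum fun k => e (k - s) • (V i (k - s) * V' k j) :=
  congrArg fsum (funext fun k => by rw [matMul_shiftDiag_apply, smul_mul_assoc])

theorem Lam_eq_shiftDiag (k : ℤ) : Lam K k = shiftDiag (fun _ => 1) k := by
  funext i j
  simp [Lam, shiftDiag]

theorem one_eq_shiftDiag : (1 : Mat K) = shiftDiag (fun _ => 1) 0 := by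
  funext i j
  simp [Matrix.one_apply, shiftDiag, sub_eq_zero, eq_comm]

theorem eps_eq_shiftDiag : eps K = shiftDiag (fun i => (i : K)) (-1) := by
  funext i j
  simp [eps, shiftDiag]

theorem epsStar_eq_shiftDiag : epsStar K = shiftDiag (fun i => ((-i : ℤ) : K)) 1 := by
  funext i j
  have h : i - j = -1 ↔ j - i = 1 := by omega
  by_cases h1 : j - i = 1
  · have : j = i + 1 := by omega
    subst this
    simp [epsStar, eps, shiftDiag, Lam]
  · simp [epsStar, eps, shiftDiag, Lam, h, h1]

theorem matPow_shiftDiag_one (s : ℤ) (n : ℕ) :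
    matPow (shiftDiag (fun _ => (1 : K)) s) n = shiftDiag (fun _ => 1) (n * s) := by
  induction n with
  | zero => simp [matPow, one_eq_shiftDiag]
  | succ n ih => rw [matPow, ih, shiftDiag_matMul_shiftDiag]; simp [add_mul]

/-- `m! (j choose m)` satisfies the recursion of the falling factorial. -/
theorem factorial_mul_choose_succ (j : ℤ) (m : ℕ) :
    ((m + 1).factorial : ℤ) * Ring.choose j (m + 1) =
      (m.factorial : ℤ) * Ring.choose j m * (j - m) := by
  have h (k : ℕ) : (k.factorial : ℤ) * Ring.choose j k = (descPochhammer ℤ k).eval j := by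
    rw [← nsmul_eq_mul, ← Ring.descPochhammer_eq_factorial_smul_choose, ← Polynomial.eval_eq_smeval]
  rw [h, h, descPochhammer_succ_eval]

theorem matPow_eps (m : ℕ) : matPow (eps K) m =
    shiftDiag (fun i => (((m.factorial : ℤ) * Ring.choose i m : ℤ) : K)) (-m) := by
  induction m with
  | zero => simp [matPow, one_eq_shiftDiag]
  | succ m ih =>
    rw [matPow, ih, eps_eq_shiftDiag, shiftDiag_matMul_shiftDiag]
    congr 1
    · funext i
      rw [factorial_mul_choose_succ]
      push_cast
      ring
    · push_cast
      ring

theorem matPow_epsStar (m : ℕ) : matPow (epsStar K) m =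
    shiftDiag (fun i => (((m.factorial : ℤ) * Ring.choose (-i) m : ℤ) : K)) m := by
  induction m with
  | zero => simp [matPow, one_eq_shiftDiag]
  | succ m ih =>
    rw [matPow, ih, epsStar_eq_shiftDiag, shiftDiag_matMul_shiftDiag]
    congr 1
    · funext i
      rw [factorial_mul_choose_succ]
      push_cast
      ring

/-- Upper negation for generalized binomial coefficients. -/
theorem choose_neg_upper (j : ℤ) (m : ℕ) :
    Ring.choose (m - 1 - j) m = (-1) ^ m * Ring.choose j m := by
  rw [show (m : ℤ) - 1 - j = -(j - m + 1) by ring, Ring.choose_neg', Units.smul_def,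
    Int.coe_negOnePow_natCast, smul_eq_mul]
  congr 2

end ShiftDiag

/-! ### Exponentials of Toeplitz matrices -/

section Toeplitz

variable {K : Type*} [Field K]

/-- The upper triangular matrix `∑ₙ pₙ Λⁿ`, where `p = ∑ₙ pₙ tⁿ`. -/
noncomputable def toeplitz (p : PowerSeries (Fn K)) : Mat K :=
  fun i j => if i ≤ j then PowerSeries.coeff (j - i).toNat p else 0

theorem toeplitz_matMul (p q : PowerSeries (Fn K)) :
    toeplitz p ⋇ toeplitz q = toeplitz (p * q) := by
  funext i j
  by_cases hij : i ≤ j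
  · obtain ⟨n, rfl⟩ : ∃ n : ℕ, j = i + n := ⟨(j - i).toNat, by omega⟩
    rw [toeplitz, if_pos hij, add_sub_cancel_left, Int.toNat_natCast, PowerSeries.coeff_mul,
      Finset.Nat.sum_antidiagonal_eq_sum_range_succ_mk]
    refine (fsum_eq_sum ((Finset.range (n + 1)).map
      (Nat.castEmbedding.trans (addLeftEmbedding i))) fun k hk => ?_).trans ?_
    · by_cases h1 : i ≤ k
      · have h2 : ¬ k ≤ i + n := fun h2 => hk <| by
          rw [Finset.mem_map]
          refine ⟨(k - i).toNat, Finset.mem_range.2 (by omega), ?_⟩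
          simp [h1]
        rw [toeplitz, toeplitz, if_neg h2, mul_zero]
      · rw [toeplitz, if_neg h1, zero_mul]
    · rw [Finset.sum_map]
      refine Finset.sum_congr rfl fun a ha => ?_
      have ha' := Finset.mem_range.1 ha
      simp only [Function.Embedding.trans_apply, Nat.castEmbedding_apply, addLeftEmbedding_apply,
        toeplitz]
      rw [if_pos (by omega), if_pos (by omega)]
      congr 3 <;> omega
  · rw [toeplitz, if_neg hij]
    refine (fsum_eq_sum ∅ fun k _ => ?_).trans Finset.sum_empty
    by_cases h1 : i ≤ k
    · rw [toeplitz, toeplitz, if_neg (show ¬ k ≤ j by omega), mul_zero]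
    · rw [toeplitz, if_neg h1, zero_mul]

theorem toeplitz_one : toeplitz (1 : PowerSeries (Fn K)) = 1 := by
  funext i j
  simp only [toeplitz, PowerSeries.coeff_one, Matrix.one_apply]
  split_ifs <;> first | rfl | omega

theorem matPow_toeplitz (p : PowerSeries (Fn K)) (n : ℕ) :
    matPow (toeplitz p) n = toeplitz (p ^ n) := by
  induction n with
  | zero => rw [matPow, pow_zero, toeplitz_one]
  | succ n ih => rw [matPow, ih, toeplitz_matMul, pow_succ]

theorem neg_toeplitz (p : PowerSeries (Fn K)) : -toeplitz p = toeplitz (-p) := by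
  funext i j
  simp only [Matrix.neg_apply, toeplitz]
  split_ifs <;> simp

variable [CharZero K]

theorem matExp_toeplitz {p : PowerSeries (Fn K)} (hp : PowerSeries.constantCoeff p = 0) :
    matExp (toeplitz p) = toeplitz ((PowerSeries.exp K).subst p) := by
  funext i j
  simp only [matExp, matPow_toeplitz]
  simp only [toeplitz]
  split_ifs with hij
  · rw [PowerSeries.coeff_subst' (PowerSeries.HasSubst.of_constantCoeff_zero' hp)]
    have h (n : ℕ) (hn : n ∉ Finset.range ((j - i).toNat + 1)) :
        PowerSeries.coeff (j - i).toNat (p ^ n) = 0 := by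
      refine PowerSeries.coeff_of_lt_order _ (lt_of_lt_of_le ?_
        (PowerSeries.le_order_pow_of_constantCoeff_eq_zero n hp))
      rw [Finset.mem_range] at hn
      exact_mod_cast by omega
    rw [fsum_eq_sum _ fun n hn => by rw [h n hn, smul_zero],
      finsum_eq_sum_of_support_subset (s := Finset.range ((j - i).toNat + 1)) _
        fun n hn => by
          by_contra hn'
          exact hn ((congrArg _ (h n hn')).trans (smul_zero _))]
    refine Finset.sum_congr rfl fun n _ => ?_
    rw [PowerSeries.coeff_exp]
    congr 1
    simp
  · rw [fsum_eq_sum ∅ fun _ _ => smul_zero _, Finset.sum_empty]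

theorem matExp_toeplitz_matMul_neg {p : PowerSeries (Fn K)}
    (hp : PowerSeries.constantCoeff p = 0) :
    matExp (toeplitz p) ⋇ matExp (-toeplitz p) = 1 := by
  have hn : PowerSeries.constantCoeff (-p) = 0 := by rw [map_neg, hp, neg_zero]
  have hs := PowerSeries.HasSubst.of_constantCoeff_zero' hp
  have h : (PowerSeries.exp K).subst (-p) =
      (PowerSeries.evalNegHom (PowerSeries.exp K)).subst p := by
    ext1 k
    rw [PowerSeries.coeff_subst' (PowerSeries.HasSubst.of_constantCoeff_zero' hn),
      PowerSeries.coeff_subst' hs]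
    refine finsum_congr fun n => ?_
    rw [PowerSeries.evalNegHom, PowerSeries.coeff_rescale]
    rcases n.even_or_odd with hn | hn <;> simp [hn.neg_pow]
  rw [neg_toeplitz, matExp_toeplitz hp, matExp_toeplitz hn, toeplitz_matMul, h,
    ← PowerSeries.subst_mul hs, PowerSeries.exp_mul_exp_neg_eq_one]
  rw [← PowerSeries.coe_substAlgHom hs, map_one, toeplitz_one]

end Toeplitz

/-! ### Reversal of the indices -/

section Reverse

variable {K : Type*} [Field K]

/-- The matrix with entries `A (-i) (-j)`. -/
def reverse (A : Mat K) : Mat K := fun i j => A (-i) (-j)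

theorem reverse_matMul (A B : Mat K) : reverse (A ⋇ B) = reverse A ⋇ reverse B := by
  funext i j
  exact (fsum_comp_equiv (Equiv.neg ℤ) fun k => A (-i) k * B k (-j)).symm

theorem reverse_one : reverse (1 : Mat K) = 1 := by
  funext i j
  simp [reverse, Matrix.one_apply]

theorem matPow_reverse (A : Mat K) (n : ℕ) : matPow (reverse A) n = reverse (matPow A n) := by
  induction n with
  | zero => rw [matPow, matPow, reverse_one]
  | succ n ih => rw [matPow, matPow, ih, reverse_matMul]

theorem matExp_reverse (A : Mat K) : matExp (reverse A) = reverse (matExp A) := by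
  funext i j
  simp only [matExp, matPow_reverse, reverse]

end Reverse

/-! ### The exponentials of `ξ(x, Λ)` and `ξ(y, Λ⁻¹)` -/

section Xi

variable {K : Type*} [Field K]

/-- `∑ₙ uₙ t^{2n+1}`. -/
noncomputable def oddSeries (u : ℕ → Fn K) : PowerSeries (Fn K) :=
  PowerSeries.mk fun k => if Odd k then u (k / 2) else 0

theorem constantCoeff_oddSeries (u : ℕ → Fn K) :
    PowerSeries.constantCoeff (oddSeries u) = 0 := by
  rw [← PowerSeries.coeff_zero_eq_constantCoeff_apply, oddSeries, PowerSeries.coeff_mk,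
    if_neg (by decide)]

theorem toeplitz_oddSeries_apply (u : ℕ → Fn K) (i j : ℤ) :
    toeplitz (oddSeries u) i j = fsum fun n : ℕ => u n * Lam K (2 * (n : ℤ) + 1) i j := by
  by_cases h : ∃ n : ℕ, j - i = 2 * (n : ℤ) + 1
  · obtain ⟨n, hn⟩ := h
    rw [fsum_eq_single n fun k hk => by rw [Lam, if_neg (by omega), mul_zero], Lam, if_pos hn,
      mul_one, toeplitz, if_pos (by omega), hn, oddSeries, PowerSeries.coeff_mk,
      show (2 * (n : ℤ) + 1).toNat = 2 * n + 1 by omega, if_pos ⟨n, rfl⟩]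
    congr 1
    omega
  · rw [fsum_eq_sum ∅ fun k _ => by
      rw [Lam, if_neg fun hk => h ⟨k, hk⟩, mul_zero], Finset.sum_empty, toeplitz]
    split_ifs with hij
    · rw [oddSeries, PowerSeries.coeff_mk, if_neg]
      rintro ⟨n, hn⟩
      exact h ⟨n, by omega⟩
    · rfl

theorem xiX_eq : xiX K = toeplitz (oddSeries fun n => X (Sum.inl n)) := by
  funext i j
  rw [toeplitz_oddSeries_apply, xiX]

theorem xiY_eq : xiY K = reverse (toeplitz (oddSeries fun n => X (Sum.inr n))) := by
  funext i j
  rw [reverse, toeplitz_oddSeries_apply, xiY]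
  congr 1
  funext n
  rw [Lam, Lam]
  congr 1
  exact if_congr (by omega) rfl rfl

theorem matExp_xiX_matMul_neg [CharZero K] : matExp (xiX K) ⋇ matExp (-xiX K) = 1 := by
  rw [xiX_eq]
  exact matExp_toeplitz_matMul_neg (constantCoeff_oddSeries _)

theorem matExp_neg_xiX_matMul [CharZero K] : matExp (-xiX K) ⋇ matExp (xiX K) = 1 := by
  have h := matExp_toeplitz_matMul_neg (p := -oddSeries fun n => (X (Sum.inl n) : Fn K))
    (by rw [map_neg, constantCoeff_oddSeries, neg_zero])
  rwa [← neg_toeplitz, neg_neg, ← xiX_eq] at h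

theorem matExp_xiY_matMul_neg [CharZero K] : matExp (xiY K) ⋇ matExp (-xiY K) = 1 := by
  have h := matExp_toeplitz_matMul_neg (constantCoeff_oddSeries fun n => (X (Sum.inr n) : Fn K))
  rw [xiY_eq]
  change matExp (reverse _) ⋇ matExp (reverse (-_)) = 1
  rw [matExp_reverse, matExp_reverse, ← reverse_matMul, h, reverse_one]

theorem matExp_neg_xiY_matMul [CharZero K] : matExp (-xiY K) ⋇ matExp (xiY K) = 1 := by
  have h := matExp_toeplitz_matMul_neg (p := -oddSeries fun n => (X (Sum.inr n) : Fn K))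
    (by rw [map_neg, constantCoeff_oddSeries, neg_zero])
  rw [← neg_toeplitz, neg_neg] at h
  rw [xiY_eq]
  change matExp (reverse (-_)) ⋇ matExp (reverse _) = 1
  rw [matExp_reverse, matExp_reverse, ← reverse_matMul, h, reverse_one]

/-- The weight with `x_{2n+1}` of weight `2n+1` and `y_{2n+1}` of weight `0`. -/
def weightX : ℕ ⊕ ℕ → ℕ := Sum.elim (fun n => 2 * n + 1) 0

/-- The weight with `x_{2n+1}` of weight `0` and `y_{2n+1}` of weight `2n+1`. -/
def weightY : ℕ ⊕ ℕ → ℕ := Sum.elim 0 fun n => 2 * n + 1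

theorem coeff_X_mul_Lam_ne_zero {t : ℕ ⊕ ℕ} {s i j : ℤ} {d : (ℕ ⊕ ℕ) →₀ ℕ}
    (h : coeff d ((X t : Fn K) * Lam K s i j) ≠ 0) : d = Finsupp.single t 1 ∧ j - i = s := by
  by_cases hs : j - i = s
  · rw [Lam, if_pos hs, mul_one, coeff_X] at h
    exact ⟨by by_contra hd; exact h (if_neg hd), hs⟩
  · exact absurd (by rw [Lam, if_neg hs, mul_zero, map_zero]) h

theorem tame_xiX : Tame 1 weightX 0 (xiX K) := by
  intro i j d h
  obtain ⟨n, hn⟩ := exists_coeff_ne_zero_of_fsum h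
  obtain ⟨rfl, hs⟩ := coeff_X_mul_Lam_ne_zero hn
  rw [Finsupp.weight_single, hs]
  simp [weightX]

theorem tame_xiY : Tame (-1) weightY 0 (xiY K) := by
  intro i j d h
  obtain ⟨n, hn⟩ := exists_coeff_ne_zero_of_fsum h
  obtain ⟨rfl, hs⟩ := coeff_X_mul_Lam_ne_zero hn
  rw [Finsupp.weight_single, hs]
  simp [weightY]

end Xi

/-! ### The wave operators -/

namespace DressingPair

variable {K : Type*} [Field K] (D : DressingPair K)

theorem tame_W₁ : Tame 1 weightX 0 D.W₁ :=
  (tame_of_lower D.S₁_lower).matMul tame_xiX.matExp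

theorem tame_W₁inv : Tame 1 weightX 0 D.W₁inv :=
  tame_xiX.neg.matExp.matMul (tame_of_lower D.S₁inv_lower)

theorem tame_W₂ : Tame (-1) weightY 0 D.W₂ :=
  (tame_of_upper D.S₂_upper).matMul tame_xiY.matExp

theorem tame_W₂inv : Tame (-1) weightY 0 D.W₂inv :=
  tame_xiY.neg.matExp.matMul (tame_of_upper D.S₂inv_upper)

end DressingPair

theorem matMul_mul_cancel {K : Type*} [Field K] {σ : ℤ} {w : ℕ ⊕ ℕ → ℕ} {A B B' A' : Mat K}
    (hσ : σ = 1 ∨ σ = -1) (hA : Tame σ w 0 A) (hB : Tame σ w 0 B) (hB' : Tame σ w 0 B')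
    (hA' : Tame σ w 0 A') (hBB' : B ⋇ B' = 1) (hAA' : A ⋇ A' = 1) :
    (A ⋇ B) ⋇ (B' ⋇ A') = 1 := by
  rw [Tame.matMul_assoc hσ hA hB (hB'.matMul hA'), ← Tame.matMul_assoc hσ hB hB' hA', hBB',
    one_matMul, hAA']

namespace DressingPair

variable {K : Type*} [Field K] [CharZero K] (D : DressingPair K)

theorem W₁_matMul_inv : D.W₁ ⋇ D.W₁inv = 1 :=
  matMul_mul_cancel (Or.inl rfl) (tame_of_lower D.S₁_lower) tame_xiX.matExp tame_xiX.neg.matExp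
    (tame_of_lower D.S₁inv_lower) matExp_xiX_matMul_neg D.S₁_mul_inv

theorem W₁inv_matMul : D.W₁inv ⋇ D.W₁ = 1 :=
  matMul_mul_cancel (Or.inl rfl) tame_xiX.neg.matExp (tame_of_lower D.S₁inv_lower)
    (tame_of_lower D.S₁_lower) tame_xiX.matExp D.S₁_inv_mul matExp_neg_xiX_matMul

theorem W₂_matMul_inv : D.W₂ ⋇ D.W₂inv = 1 :=
  matMul_mul_cancel (Or.inr rfl) (tame_of_upper D.S₂_upper) tame_xiY.matExp tame_xiY.neg.matExp
    (tame_of_upper D.S₂inv_upper) matExp_xiY_matMul_neg D.S₂_mul_inv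

theorem W₂inv_matMul : D.W₂inv ⋇ D.W₂ = 1 :=
  matMul_mul_cancel (Or.inr rfl) tame_xiY.neg.matExp (tame_of_upper D.S₂inv_upper)
    (tame_of_upper D.S₂_upper) tame_xiY.matExp D.S₂_inv_mul matExp_neg_xiY_matMul

end DressingPair

/-! ### The lower and upper parts acting on the wave operators -/

section Parts

variable {K : Type*} [Field K] (D : DressingPair K)

theorem serMatMulConverges_lowerPart (Y : Matrix ℤ ℤ (Ser K)) :
    SerMatMulConverges (lowerPart Y) D.W₁ := fun i j m n =>
  Tame.summable (Or.inl rfl) (tame_of_lower (A := fun i k => lowerPart Y i k m n) (w := weightX)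
    fun i k h => by rw [lowerPart, if_neg (by omega)]; rfl) D.tame_W₁ i j

theorem serMatMulConverges_upperPart (Y : Matrix ℤ ℤ (Ser K)) :
    SerMatMulConverges (upperPart Y) D.W₂ := fun i j m n =>
  Tame.summable (Or.inr rfl) (tame_of_upper (A := fun i k => upperPart Y i k m n) (w := weightY)
    fun i k h => by rw [upperPart, if_neg (by omega)]; rfl) D.tame_W₂ i j

theorem serMatMul_lowerPart_apply {Y : Matrix ℤ ℤ (Ser K)} {A : Mat K} {c : K} {m : ℕ} {n : ℤ}
    (h : ∀ i k, Y i k m n = c • A i k) (B : Mat K) (i j : ℤ) :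
    serMatMul (lowerPart Y) B i j m n = c • (lowerPart A ⋇ B) i j := by
  refine Eq.trans (congrArg fsum (funext fun k => ?_)) (fsum_smul c fun k => lowerPart A i k * B k j)
  rw [lowerPart, lowerPart, ← smul_mul_assoc]
  split_ifs
  · rw [h]
  · rw [smul_zero]
    rfl

theorem serMatMul_upperPart_apply {Y : Matrix ℤ ℤ (Ser K)} {A : Mat K} {c : K} {m : ℕ} {n : ℤ}
    (h : ∀ i k, Y i k m n = c • A i k) (B : Mat K) (i j : ℤ) :
    serMatMul (upperPart Y) B i j m n = c • (upperPart A ⋇ B) i j := by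
  refine Eq.trans (congrArg fsum (funext fun k => ?_)) (fsum_smul c fun k => upperPart A i k * B k j)
  rw [upperPart, upperPart, ← smul_mul_assoc]
  split_ifs
  · rw [h]
  · rw [smul_zero]
    rfl

theorem lowerPart_zero : lowerPart (0 : Mat K) = 0 := by
  funext i j
  simp [lowerPart]

theorem upperPart_zero : upperPart (0 : Mat K) = 0 := by
  funext i j
  simp [upperPart]

/-- Only one term of the expansion contributes to each coefficient. -/
theorem isNegExpansion_of_coeff {F : ℕ → ℤ → Mat K} {Y : Matrix ℤ ℤ (Ser K)}
    (h : ∀ i j m n, Y i j m n = -((m.factorial : K)⁻¹ • F m (-n - 1) i j)) :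
    IsNegExpansion F Y := by
  intro i j m n
  have h0 (p : ℕ × ℤ) (hp : p ≠ (m, -n - m - 1)) : (-expansionTerm F i j p) m n = 0 := by
    rw [Pi.neg_apply, Pi.neg_apply, expansionTerm, Ser.monomial, if_neg, neg_zero]
    rintro ⟨rfl, hn⟩
    exact hp (Prod.ext rfl (by simp only; omega))
  refine ⟨fun d => (Set.finite_singleton (m, -n - m - 1)).subset fun p hp => ?_, ?_⟩
  · by_contra hpm
    exact hp ((congrArg (coeff d) (h0 p hpm)).trans (map_zero _))
  · rw [fsum_eq_single _ h0, h, Pi.neg_apply, Pi.neg_apply, expansionTerm, Ser.monomial,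
      if_pos ⟨rfl, by simp only; omega⟩]
    simp only
    rw [show (m : ℤ) + (-n - m - 1) = -n - 1 by ring]

end Parts

/-! ### Eigenfunctions -/

section Eigenfunction

variable {K : Type*} [Field K] {D : DressingPair K}

/-- Linear combinations of the columns of the wave operators are eigenfunctions. -/
theorem isEigenfunction_of_columns (hD : D.IsBTL) {q : Vec K} {V : Mat K}
    (hV : V = D.W₁ ∨ V = D.W₂)
    (h : ∀ m n, ∃ (c : K) (s : ℤ), ∀ i, q i m n = c • V i s) : D.IsEigenfunction q := by
  have key (t : ℕ ⊕ ℕ) (B : Mat K) (hB : matDeriv t V = B ⋇ V) (i : ℤ) (m : ℕ) (r : ℤ) :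
      MvPowerSeries.pderiv K t (q i m r) = matVec B q i m r := by
    obtain ⟨c, s, hc⟩ := h m r
    rw [hc, Derivation.map_smul]
    refine (congrArg (c • ·) (congrFun (congrFun hB i) s)).trans ?_
    rw [matVec]
    simp only [hc, mul_smul_comm]
    rw [fsum_smul]
    rfl
  have hx (n : ℕ) := Prod.ext_iff.1 (hD.evolution_x n)
  have hy (n : ℕ) := Prod.ext_iff.1 (hD.evolution_y n)
  simp only [pairMul, plusPart, DressingPair.W, lowerPart_zero, upperPart_zero, add_zero,
    zero_add] at hx hy
  rcases hV with rfl | rfl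
  · exact ⟨fun n => key _ _ (hx n).1, fun n => key _ _ (hy n).1⟩
  · exact ⟨fun n => key _ _ (hx n).2, fun n => key _ _ (hy n).2⟩

end Eigenfunction

/-! ### Coefficients of the generators -/

section Coefficients

variable {K : Type*} [Field K] (U : Mat K)

theorem matVec_muPow_apply (i : ℤ) (m : ℕ) (n : ℤ) :
    matVec U (Ser.muPow K) i m n = ((Ring.choose (n + m) m : ℤ) : K) • U i (n + m) := by
  refine (fsum_eq_single (n + m) fun k hk => ?_).trans ?_
  · rw [Ser.muPow, if_neg (by omega), mul_zero]
  · rw [Ser.muPow, if_pos (by omega), smul_eq_C_mul, map_intCast, mul_comm]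

theorem matVec_negLamPow_zero_apply (i n : ℤ) :
    matVec U (Ser.negLamPow K) i 0 n = ((-1 : K) ^ n) • U i n := by
  refine (fsum_eq_single n fun k hk => ?_).trans ?_
  · rw [Ser.negLamPow, Ser.monomial, if_neg (by omega), mul_zero]
  · rw [Ser.negLamPow, Ser.monomial, if_pos ⟨rfl, rfl⟩, smul_eq_C_mul, mul_comm]

theorem matVec_negLamPow_apply_of_ne {m : ℕ} (hm : m ≠ 0) (i n : ℤ) :
    matVec U (Ser.negLamPow K) i m n = 0 := by
  refine (fsum_eq_sum ∅ fun k _ => ?_).trans Finset.sum_empty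
  rw [Ser.negLamPow, Ser.monomial, if_neg fun h => hm h.1, mul_zero]

theorem lamInv_apply (a : Ser K) (m : ℕ) (n : ℤ) : Ser.lamInv a m n = a m (n + 1) := by
  refine (fsum_eq_single (-1) fun p hp => ?_).trans ?_
  · refine Finset.sum_eq_zero fun e _ => ?_
    rw [Ser.monomial, if_neg fun h => hp h.2, zero_mul]
  · rw [Finset.sum_eq_single (0, m)]
    · rw [Ser.monomial, if_pos ⟨rfl, rfl⟩, one_mul, sub_neg_eq_add]
    · intro e he hne
      rw [Ser.monomial, if_neg, zero_mul]
      rintro ⟨h0, -⟩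
      refine hne (Prod.ext h0 ?_)
      have := Finset.HasAntidiagonal.mem_antidiagonal.1 he
      simp only
      omega
    · intro h
      exact absurd (Finset.HasAntidiagonal.mem_antidiagonal.2 (zero_add m)) h

/-- `λ⁻¹ U χ(-λ)`. -/
noncomputable abbrev lamInvVec : Vec K :=
  fun i => Ser.lamInv (matVec U (Ser.negLamPow K) i)

theorem lamInvVec_zero_apply (i n : ℤ) :
    lamInvVec U i 0 n = ((-1 : K) ^ (n + 1)) • U i (n + 1) := by
  rw [lamInvVec, lamInv_apply, matVec_negLamPow_zero_apply]

theorem lamInvVec_apply_of_ne {m : ℕ} (hm : m ≠ 0) (i n : ℤ) : lamInvVec U i m n = 0 := by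
  rw [lamInvVec, lamInv_apply, matVec_negLamPow_apply_of_ne U hm]

theorem matVec_J_apply (q : Vec K) (j : ℤ) (m : ℕ) (n : ℤ) :
    matVec (J K) q j m n = ((-1 : K) ^ j) • q (-j) m n := by
  refine (fsum_eq_single (-j) fun k hk => ?_).trans ?_
  · rw [J, if_neg (by omega), zero_mul]
  · rw [J, if_pos (by omega), smul_eq_C_mul]

theorem J_matMul_transpose_matMul_J_apply (A : Mat K) (i j : ℤ) :
    (J K ⋇ A.transpose ⋇ J K) i j = ((-1 : K) ^ (i + j)) • A (-j) (-i) := by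
  have h1 : (J K ⋇ A.transpose) i (-j) = ((-1 : K) ^ i) • A (-j) (-i) := by
    refine (fsum_eq_single (-i) fun k hk => ?_).trans ?_
    · rw [J, if_neg (by omega), zero_mul]
    · rw [J, if_pos (by omega), smul_eq_C_mul, Matrix.transpose_apply]
  refine (fsum_eq_single (-j) fun k hk => ?_).trans ?_
  · rw [J, if_neg (by omega), mul_zero]
  · rw [J, if_pos (by omega), h1, mul_comm, ← smul_eq_C_mul, smul_smul, zpow_add₀ (by simp),
      zpow_neg, ← inv_zpow, inv_neg_one, mul_comm]

end Coefficients

section Tensor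

variable {K : Type*} [Field K] {U U' : Mat K}

theorem neg_one_zpow_eq {a b : ℤ} (c : ℤ) (h : a = b + 2 * c) : (-1 : K) ^ a = (-1) ^ b := by
  rw [h, zpow_add₀ (by simp), (even_two_mul c).neg_one_zpow, mul_one]

/-- The terms of the sum that defines a coefficient of `U χ(μ) ⊗ J λ⁻¹ U χ(-λ)`. -/
theorem tensor_term_muPow_lamInvVec
    (hU : ∀ a j, U' a j = ((-1 : K) ^ (a + j)) • U (-j) (-a)) (i j : ℤ) (m : ℕ) (n p : ℤ) :
    ∑ e ∈ Finset.HasAntidiagonal.antidiagonal m,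
        matVec U (Ser.muPow K) i e.1 p * matVec (J K) (lamInvVec U) j e.2 (n - p) =
      ((Ring.choose (p + m) m : ℤ) : K) • (U i (p + m) * U' (p - n - 1) j) := by
  rw [Finset.sum_eq_single (m, 0)]
  · rw [matVec_muPow_apply, matVec_J_apply, lamInvVec_zero_apply, hU, smul_smul, smul_mul_smul_comm,
      mul_smul_comm, smul_smul, show -(p - n - 1) = n - p + 1 by ring]
    rw [← zpow_add₀ (by simp),
      neg_one_zpow_eq (a := p - n - 1 + j) (b := j + (n - p + 1)) (p - n - 1) (by ring)]
  · intro e he hne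
    rw [matVec_J_apply, lamInvVec_apply_of_ne, smul_zero, mul_zero]
    intro h0
    refine hne (Prod.ext ?_ h0)
    have := Finset.HasAntidiagonal.mem_antidiagonal.1 he
    simp only
    omega
  · intro h
    exact absurd (Finset.HasAntidiagonal.mem_antidiagonal.2 (add_zero m)) h

/-- The terms of the sum that defines a coefficient of `λ⁻¹ U χ(-λ) ⊗ J U χ(μ)`. -/
theorem tensor_term_lamInvVec_muPow
    (hU : ∀ a j, U' a j = ((-1 : K) ^ (a + j)) • U (-j) (-a)) (i j : ℤ) (m : ℕ) (n p : ℤ) :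
    ∑ e ∈ Finset.HasAntidiagonal.antidiagonal m,
        lamInvVec U i e.1 p * matVec (J K) (matVec U (Ser.muPow K)) j e.2 (n - p) =
      ((-1 : K) ^ (-n - 1) * ((Ring.choose (p - n - 1) m : ℤ) : K)) •
        (U i (p + 1) * U' (p - n - m) j) := by
  rw [Finset.sum_eq_single (0, m)]
  · rw [matVec_J_apply, matVec_muPow_apply, lamInvVec_zero_apply, hU, smul_smul,
      smul_mul_smul_comm, mul_smul_comm, smul_smul, show -(p - n - m) = n - p + m by ring]
    congr 1
    have h := choose_neg_upper (p - n - 1) m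
    rw [show (m : ℤ) - 1 - (p - n - 1) = n - p + m by ring] at h
    rw [h]
    push_cast
    have h1 : (-1 : K) ^ (p + 1) * (-1) ^ j * (-1) ^ m =
        (-1) ^ (-n - 1) * (-1) ^ (p - n - m + j) := by
      rw [← zpow_natCast (-1 : K) m, ← zpow_add₀ (by simp), ← zpow_add₀ (by simp),
        ← zpow_add₀ (by simp)]
      exact neg_one_zpow_eq (1 + m + n) (by ring)
    linear_combination ((Ring.choose (p - n - 1) m : ℤ) : K) * h1
  · intro e he hne
    rw [lamInvVec_apply_of_ne, zero_mul]
    intro h0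
    refine hne (Prod.ext h0 ?_)
    have := Finset.HasAntidiagonal.mem_antidiagonal.1 he
    simp only
    omega
  · intro h
    exact absurd (Finset.HasAntidiagonal.mem_antidiagonal.2 (zero_add m)) h

end Tensor

/-! ### Signs -/

section Neg

variable {K : Type*} [Field K]

theorem matVec_neg (A : Mat K) (q : Vec K) : matVec A (-q) = -matVec A q := by
  funext i m n
  exact (congrArg fsum (funext fun k => mul_neg (A i k) (q k m n))).trans (fsum_neg _)

theorem neg_mul_term (a b : Ser K) (m : ℕ) (n p : ℤ) :
    ∑ e ∈ Finset.HasAntidiagonal.antidiagonal m, (-a) e.1 p * b e.2 (n - p) =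
      -∑ e ∈ Finset.HasAntidiagonal.antidiagonal m, a e.1 p * b e.2 (n - p) := by
  rw [← Finset.sum_neg_distrib]
  exact Finset.sum_congr rfl fun e _ => neg_mul _ _

theorem mul_neg_term (a b : Ser K) (m : ℕ) (n p : ℤ) :
    ∑ e ∈ Finset.HasAntidiagonal.antidiagonal m, a e.1 p * (-b) e.2 (n - p) =
      -∑ e ∈ Finset.HasAntidiagonal.antidiagonal m, a e.1 p * b e.2 (n - p) := by
  rw [← Finset.sum_neg_distrib]
  exact Finset.sum_congr rfl fun e _ => mul_neg _ _

theorem Ser.MulConverges.neg_left {a b : Ser K} (h : Ser.MulConverges a b) :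
    Ser.MulConverges (-a) b := fun m n => by
  simp only [neg_mul_term]
  exact (h m n).neg

theorem Ser.MulConverges.neg_right {a b : Ser K} (h : Ser.MulConverges a b) :
    Ser.MulConverges a (-b) := fun m n => by
  simp only [mul_neg_term]
  exact (h m n).neg

theorem Ser.neg_mul (a b : Ser K) : Ser.mul (-a) b = -Ser.mul a b := by
  funext m n
  exact (congrArg fsum (funext fun p => neg_mul_term a b m n p)).trans (fsum_neg _)

theorem Ser.mul_neg (a b : Ser K) : Ser.mul a (-b) = -Ser.mul a b := by
  funext m n
  exact (congrArg fsum (funext fun p => mul_neg_term a b m n p)).trans (fsum_neg _)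

theorem sqEigMatrix_neg_left (q₁ q₂ : Vec K) : sqEigMatrix (-q₁) q₂ = -sqEigMatrix q₁ q₂ := by
  funext i j
  simp only [sqEigMatrix, tensor, matVec_neg, Matrix.sub_apply, Matrix.neg_apply, Pi.neg_apply,
    Ser.neg_mul, Ser.mul_neg]
  abel

end Neg

/-! ### The squared eigenfunction matrix -/

section SqEig

variable {K : Type*} [Field K] {σ : ℤ} {w : ℕ ⊕ ℕ → ℕ} {V V' E : Mat K} {s c : ℤ}

/-- The affine substitution `p ↦ s (p + a)` of the integers, where `s = ± 1`. -/
def affineEquiv (hs : s * s = 1) (a : ℤ) : ℤ ≃ ℤ where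
  toFun p := s * (p + a)
  invFun k := s * k - a
  left_inv p := by linear_combination (p + a) * hs
  right_inv k := by linear_combination k * hs

theorem summable_columns (hσ : σ = 1 ∨ σ = -1) (hV : Tame σ w 0 V) (hV' : Tame σ w 0 V')
    (hs : s * s = 1) (a b i j : ℤ) :
    FormallySummable fun p => V i (s * (p + b)) * V' (s * (p + a)) j := by
  have h := ((hV.matMul (tame_shiftDiag σ w (fun _ => 1) (s * (a - b)))).summable hσ hV' i
    j).comp_equiv (affineEquiv hs a)
  simp only [matMul_shiftDiag_apply, one_smul] at h
  convert h using 4 with p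
  · simp only [affineEquiv, Equiv.coe_fn_mk]
    ring
  · rfl

theorem conj_shiftDiag_apply_affine (V V' : Mat K) (hs : s * s = 1) (e : ℤ → K)
    (a b r i j : ℤ) (hr : r = s * (a - b)) : (V ⋇ shiftDiag e r ⋇ V') i j =
      fsum fun p => e (s * (p + b)) • (V i (s * (p + b)) * V' (s * (p + a)) j) := by
  rw [conj_shiftDiag_apply, ← fsum_comp_equiv (affineEquiv hs a)]
  congr 1
  funext p
  simp only [affineEquiv, Equiv.coe_fn_mk]
  rw [show s * (p + a) - r = s * (p + b) by rw [hr]; ring]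

theorem matZPow_conj_Lam (hσ : σ = 1 ∨ σ = -1) (hV : Tame σ w 0 V) (hV' : Tame σ w 0 V')
    (hVV' : V ⋇ V' = 1) (hV'V : V' ⋇ V = 1) (s t l : ℤ) (ht : t = -s) :
    matZPow (V ⋇ Lam K s ⋇ V') (V ⋇ Lam K t ⋇ V') l =
      V ⋇ shiftDiag (fun _ => 1) (l * s) ⋇ V' := by
  rw [matZPow, Lam_eq_shiftDiag, Lam_eq_shiftDiag,
    matPow_conj hσ hV hV' hVV' hV'V (tame_shiftDiag _ _ _ _),
    matPow_conj hσ hV hV' hVV' hV'V (tame_shiftDiag _ _ _ _), matPow_shiftDiag_one,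
    matPow_shiftDiag_one, ht]
  split_ifs with h
  · rw [Int.toNat_of_nonneg h]
  · rw [Int.toNat_of_nonneg (by omega), neg_mul_neg]

/-- The matrix with entries `V i (s a)`. -/
def scaleColumns (s : ℤ) (V : Mat K) : Mat K := fun i a => V i (s * a)

theorem columns_constraint (hs : s * s = 1) (hJ : J K ⋇ V.transpose ⋇ J K = V') (a j : ℤ) :
    V' (s * a) j = ((-1 : K) ^ (a + j)) • scaleColumns s V (-j) (-a) := by
  rw [scaleColumns, ← hJ, J_matMul_transpose_matMul_J_apply, mul_neg]
  rcases mul_self_eq_one_iff.1 hs with rfl | rfl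
  · rw [one_mul]
  · rw [neg_one_zpow_eq (a := -1 * a + j) (b := a + j) (-a) (by ring)]

/-- The convergence of the products of the wave functions `V χ(μ^s)` and `V χ((-λ)^s)`. -/
theorem mulConverges_tensor (hσ : σ = 1 ∨ σ = -1) (hV : Tame σ w 0 V) (hV' : Tame σ w 0 V')
    (hs : s * s = 1) (hJ : J K ⋇ V.transpose ⋇ J K = V') (i j : ℤ) :
    Ser.MulConverges (matVec (scaleColumns s V) (Ser.muPow K) i)
        (matVec (J K) (lamInvVec (scaleColumns s V)) j) ∧
      Ser.MulConverges (lamInvVec (scaleColumns s V) i)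
        (matVec (J K) (matVec (scaleColumns s V) (Ser.muPow K)) j) := by
  refine ⟨fun m n => ?_, fun m n => ?_⟩
  · simp only [tensor_term_muPow_lamInvVec (U' := fun a j => V' (s * a) j)
      (columns_constraint hs hJ)]
    exact (summable_columns hσ hV hV' hs (-n - 1) m i j).smul _ |> fun h => by
      convert h using 5
      · rfl
      · ring
  · simp only [tensor_term_lamInvVec_muPow (U' := fun a j => V' (s * a) j)
      (columns_constraint hs hJ)]
    exact (summable_columns hσ hV hV' hs (-n - m) 1 i j).smul _ |> fun h => by
      convert h using 5
      · rfl
      · ring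

/-- The squared eigenfunction matrix generated by `V χ(μ^s)` and `λ⁻¹ V χ((-λ)^s)` is a generating
function of the matrices `M^m L^l - (-1)^l L^{l-1} M^m L`. -/
theorem sqEigMatrix_apply [CharZero K] (hσ : σ = 1 ∨ σ = -1) (hV : Tame σ w 0 V)
    (hV' : Tame σ w 0 V') (hVV' : V ⋇ V' = 1) (hV'V : V' ⋇ V = 1) (hs : s * s = 1)
    (hJ : J K ⋇ V.transpose ⋇ J K = V') (hE : Tame σ w c E)
    (hEm : ∀ m : ℕ, matPow E m =
      shiftDiag (fun i => (((m.factorial : ℤ) * Ring.choose (s * i) m : ℤ) : K)) (-(s * m)))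
    {L : ℤ → Mat K} (hL : ∀ l, L l = V ⋇ shiftDiag (fun _ => 1) (l * s) ⋇ V')
    (i j : ℤ) (m : ℕ) (n : ℤ) :
    sqEigMatrix (matVec (scaleColumns s V) (Ser.muPow K))
        (lamInvVec (scaleColumns s V)) i j m n =
      (m.factorial : K)⁻¹ • (matPow (V ⋇ E ⋇ V') m ⋇ L (-n - 1) - ((-1 : K) ^ (-n - 1)) •
        (L (-n - 1 - 1) ⋇ matPow (V ⋇ E ⋇ V') m ⋇ L 1)) i j := by
  have hm : (m.factorial : K) ≠ 0 := Nat.cast_ne_zero.2 m.factorial_ne_zero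
  rw [matPow_conj hσ hV hV' hVV' hV'V hE, hEm, hL, hL, hL,
    conj_matMul_conj hσ hV hV' hV'V (tame_shiftDiag _ _ _ _) (tame_shiftDiag _ _ _ _),
    conj_matMul_conj hσ hV hV' hV'V (tame_shiftDiag _ _ _ _) (tame_shiftDiag _ _ _ _),
    shiftDiag_matMul_shiftDiag, shiftDiag_matMul_shiftDiag,
    conj_matMul_conj hσ hV hV' hV'V (tame_shiftDiag _ _ _ _) (tame_shiftDiag _ _ _ _),
    shiftDiag_matMul_shiftDiag, Matrix.sub_apply, Matrix.smul_apply,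
    conj_shiftDiag_apply_affine V V' hs _ (-n - 1) m _ i j (by ring),
    conj_shiftDiag_apply_affine V V' hs _ (-n - m) 1 _ i j (by ring), smul_sub, smul_smul,
    ← fsum_smul, ← fsum_smul]
  change fsum (K := K) _ - fsum (K := K) _ = _
  congr 2
  · funext p
    rw [tensor_term_muPow_lamInvVec (U' := fun a j => V' (s * a) j) (columns_constraint hs hJ),
      smul_smul]
    congr 1
    · rw [show s * (s * (p + m)) = p + m by linear_combination (p + m) * hs]
      push_cast
      field_simp
    · congr 2
      ring
  · funext p
    rw [tensor_term_lamInvVec_muPow (U' := fun a j => V' (s * a) j) (columns_constraint hs hJ),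
      smul_smul]
    congr 1
    · rw [show s * (s * (p + 1) + (-n - 1 - 1) * s) = p - n - 1 by
        linear_combination (p - n - 1) * hs]
      push_cast
      field_simp
    · congr 2
      ring

end SqEig

theorem scaleColumns_one {K : Type*} [Field K] (V : Mat K) : scaleColumns 1 V = V := by
  funext i a
  rw [scaleColumns, one_mul]

namespace DressingPair

section Eigenfunction

variable {K : Type*} [Field K] {D : DressingPair K}

theorem isEigenfunction_muPow (hD : D.IsBTL) {V : Mat K} (hV : V = D.W₁ ∨ V = D.W₂) (s : ℤ) :
    D.IsEigenfunction (matVec (scaleColumns s V) (Ser.muPow K)) :=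
  isEigenfunction_of_columns hD hV fun m n =>
    ⟨_, _, fun i => matVec_muPow_apply (scaleColumns s V) i m n⟩

theorem isEigenfunction_neg_muPow (hD : D.IsBTL) {V : Mat K} (hV : V = D.W₁ ∨ V = D.W₂) (s : ℤ) :
    D.IsEigenfunction (-matVec (scaleColumns s V) (Ser.muPow K)) :=
  isEigenfunction_of_columns hD hV fun m n => ⟨-((Ring.choose (n + m) m : ℤ) : K), s * (n + m),
    fun i => by
      rw [Pi.neg_apply, Pi.neg_apply, Pi.neg_apply, matVec_muPow_apply, neg_smul, scaleColumns]⟩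

theorem isEigenfunction_lamInvVec (hD : D.IsBTL) {V : Mat K} (hV : V = D.W₁ ∨ V = D.W₂) (s : ℤ) :
    D.IsEigenfunction (lamInvVec (scaleColumns s V)) := by
  refine isEigenfunction_of_columns hD hV fun m n => ?_
  by_cases hm : m = 0
  · subst hm
    exact ⟨_, _, fun i => lamInvVec_zero_apply (scaleColumns s V) i n⟩
  · exact ⟨0, 0, fun i => by rw [lamInvVec_apply_of_ne _ hm, zero_smul]⟩

end Eigenfunction

variable {K : Type*} [Field K] (D : DressingPair K)

theorem Psi₁Mu_eq : D.Psi₁Mu = matVec (scaleColumns 1 D.W₁) (Ser.muPow K) := by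
  rw [scaleColumns_one, Psi₁Mu]

theorem lamInv_Psi₁NegLam_eq :
    (fun i => Ser.lamInv (D.Psi₁NegLam i)) = lamInvVec (scaleColumns 1 D.W₁) := by
  rw [scaleColumns_one]
  rfl

theorem Psi₂MuInv_eq : D.Psi₂MuInv = matVec (scaleColumns (-1) D.W₂) (Ser.muPow K) := by
  funext i m n
  rw [Psi₂MuInv, matVec, matVec, ← fsum_comp_equiv (Equiv.neg ℤ)]
  simp [scaleColumns]

theorem lamInv_Psi₂NegLamInv_eq :
    (fun i => Ser.lamInv (D.Psi₂NegLamInv i)) = lamInvVec (scaleColumns (-1) D.W₂) := by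
  funext i
  rw [lamInvVec]
  congr 1
  funext m n
  rw [Psi₂NegLamInv, matVec, matVec, ← fsum_comp_equiv (Equiv.neg ℤ)]
  simp [scaleColumns]

variable {D} in
theorem generatesSqEigFlow_Psi₁ (hD : D.IsBTL) :
    D.GeneratesSqEigFlow D.Psi₁Mu (fun i => Ser.lamInv (D.Psi₁NegLam i)) where
  eigenfunction₁ := by
    rw [Psi₁Mu_eq]
    exact isEigenfunction_muPow hD (Or.inl rfl) 1
  eigenfunction₂ := by
    rw [lamInv_Psi₁NegLam_eq]
    exact isEigenfunction_lamInvVec hD (Or.inl rfl) 1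
  tensor₁ i j := by
    rw [Psi₁Mu_eq, lamInv_Psi₁NegLam_eq]
    exact (mulConverges_tensor (Or.inl rfl) D.tame_W₁ D.tame_W₁inv (by norm_num) hD.constraint₁
      i j).1
  tensor₂ i j := by
    rw [Psi₁Mu_eq]
    have h := (mulConverges_tensor (Or.inl rfl) D.tame_W₁ D.tame_W₁inv (s := 1) (by norm_num)
      hD.constraint₁ i j).2
    rwa [← lamInv_Psi₁NegLam_eq] at h
  flow₁ := serMatMulConverges_lowerPart D _
  flow₂ := serMatMulConverges_upperPart D _

variable {D} in
theorem generatesSqEigFlow_Psi₂ (hD : D.IsBTL) :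
    D.GeneratesSqEigFlow (-D.Psi₂MuInv) (fun i => Ser.lamInv (D.Psi₂NegLamInv i)) where
  eigenfunction₁ := by
    rw [Psi₂MuInv_eq]
    exact isEigenfunction_neg_muPow hD (Or.inr rfl) (-1)
  eigenfunction₂ := by
    rw [lamInv_Psi₂NegLamInv_eq]
    exact isEigenfunction_lamInvVec hD (Or.inr rfl) (-1)
  tensor₁ i j := by
    rw [Psi₂MuInv_eq, lamInv_Psi₂NegLamInv_eq]
    exact (mulConverges_tensor (Or.inr rfl) D.tame_W₂ D.tame_W₂inv (by norm_num) hD.constraint₂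
      i j).1.neg_left
  tensor₂ i j := by
    rw [Psi₂MuInv_eq, matVec_neg]
    have h := (mulConverges_tensor (Or.inr rfl) D.tame_W₂ D.tame_W₂inv (s := -1) (by norm_num)
      hD.constraint₂ i j).2.neg_right
    rwa [← lamInv_Psi₂NegLamInv_eq] at h
  flow₁ := serMatMulConverges_lowerPart D _
  flow₂ := serMatMulConverges_upperPart D _

variable [CharZero K]

theorem L₁pow_eq (l : ℤ) :
    D.L₁pow l = D.W₁ ⋇ shiftDiag (fun _ => 1) (l * 1) ⋇ D.W₁inv :=
  matZPow_conj_Lam (Or.inl rfl) D.tame_W₁ D.tame_W₁inv D.W₁_matMul_inv D.W₁inv_matMul 1 (-1) l rfl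

theorem L₂pow_eq (l : ℤ) :
    D.L₂pow l = D.W₂ ⋇ shiftDiag (fun _ => 1) (l * -1) ⋇ D.W₂inv :=
  matZPow_conj_Lam (Or.inr rfl) D.tame_W₂ D.tame_W₂inv D.W₂_matMul_inv D.W₂inv_matMul (-1) 1 l rfl

variable {D}

/-- The generating function of the matrices `A_{1ml}`. -/
theorem sqEigMatrix_Psi₁_apply (hD : D.IsBTL) (i j : ℤ) (m : ℕ) (n : ℤ) :
    sqEigMatrix D.Psi₁Mu (fun i => Ser.lamInv (D.Psi₁NegLam i)) i j m n =
      (m.factorial : K)⁻¹ • D.A₁ m (-n - 1) i j := by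
  rw [Psi₁Mu_eq, lamInv_Psi₁NegLam_eq]
  refine sqEigMatrix_apply (Or.inl rfl) D.tame_W₁ D.tame_W₁inv D.W₁_matMul_inv D.W₁inv_matMul
    (by norm_num) hD.constraint₁ (E := eps K) (by
      rw [eps_eq_shiftDiag]
      exact tame_shiftDiag _ _ _ _) (fun m => ?_) D.L₁pow_eq i j m n
  simp only [matPow_eps, one_mul]

/-- The generating function of the matrices `A_{2ml}`. -/
theorem sqEigMatrix_Psi₂_apply (hD : D.IsBTL) (i j : ℤ) (m : ℕ) (n : ℤ) :
    sqEigMatrix (-D.Psi₂MuInv) (fun i => Ser.lamInv (D.Psi₂NegLamInv i)) i j m n =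
      (-(m.factorial : K)⁻¹) • D.A₂ m (-n - 1) i j := by
  rw [Psi₂MuInv_eq, lamInv_Psi₂NegLamInv_eq, sqEigMatrix_neg_left, neg_smul]
  refine congrArg Neg.neg (sqEigMatrix_apply (Or.inr rfl) D.tame_W₂ D.tame_W₂inv D.W₂_matMul_inv
    D.W₂inv_matMul (by norm_num) hD.constraint₂ (E := epsStar K) (by
      rw [epsStar_eq_shiftDiag]
      exact tame_shiftDiag _ _ _ _) (fun m => ?_) D.L₂pow_eq i j m n)
  simp only [matPow_epsStar, neg_mul, one_mul, neg_neg]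

end DressingPair

end BTL

theorem mainTheorem3 {K : Type*} [Field K] [CharZero K] (D : BTL.DressingPair K) (hD : D.IsBTL) :
    -- the flow `∂_{α₁}`, generated by `Ψ₁(μ)` and `λ⁻¹Ψ₁(-λ)`
    (D.GeneratesSqEigFlow D.Psi₁Mu (fun i => BTL.Ser.lamInv (D.Psi₁NegLam i)) ∧
      BTL.IsNegExpansion (fun m l => (D.addFlowX m l).1)
        (D.sqEigFlow D.Psi₁Mu (fun i => BTL.Ser.lamInv (D.Psi₁NegLam i))).1 ∧
      BTL.IsNegExpansion (fun m l => (D.addFlowX m l).2)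
        (D.sqEigFlow D.Psi₁Mu (fun i => BTL.Ser.lamInv (D.Psi₁NegLam i))).2) ∧
    -- the flow `∂_{α₂}`, generated by `-Ψ₂(μ⁻¹)` and `λ⁻¹Ψ₂(-λ⁻¹)`
    (D.GeneratesSqEigFlow (-D.Psi₂MuInv) (fun i => BTL.Ser.lamInv (D.Psi₂NegLamInv i)) ∧
      BTL.IsNegExpansion (fun m l => (D.addFlowY m l).1)
        (D.sqEigFlow (-D.Psi₂MuInv) (fun i => BTL.Ser.lamInv (D.Psi₂NegLamInv i))).1 ∧
      BTL.IsNegExpansion (fun m l => (D.addFlowY m l).2)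
        (D.sqEigFlow (-D.Psi₂MuInv) (fun i => BTL.Ser.lamInv (D.Psi₂NegLamInv i))).2) := by
  refine ⟨⟨BTL.DressingPair.generatesSqEigFlow_Psi₁ hD, BTL.isNegExpansion_of_coeff ?_,
    BTL.isNegExpansion_of_coeff ?_⟩, BTL.DressingPair.generatesSqEigFlow_Psi₂ hD,
    BTL.isNegExpansion_of_coeff ?_, BTL.isNegExpansion_of_coeff ?_⟩ <;> intro i j m n
  · refine (BTL.serMatMul_lowerPart_apply
      (fun i k => BTL.DressingPair.sqEigMatrix_Psi₁_apply hD i k m n) D.W₁ i j).trans ?_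
    simp [BTL.DressingPair.addFlowX, BTL.pairMul, BTL.minusPart, BTL.lowerPart_zero,
      BTL.neg_matMul, BTL.DressingPair.W]
  · refine (congrArg Neg.neg (BTL.serMatMul_upperPart_apply
      (fun i k => BTL.DressingPair.sqEigMatrix_Psi₁_apply hD i k m n) D.W₂ i j)).trans ?_
    simp [BTL.DressingPair.addFlowX, BTL.pairMul, BTL.minusPart, BTL.upperPart_zero,
      BTL.DressingPair.W]
  · refine (BTL.serMatMul_lowerPart_apply
      (fun i k => BTL.DressingPair.sqEigMatrix_Psi₂_apply hD i k m n) D.W₁ i j).trans ?_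
    simp [BTL.DressingPair.addFlowY, BTL.pairMul, BTL.minusPart, BTL.lowerPart_zero,
      BTL.DressingPair.W]
  · refine (congrArg Neg.neg (BTL.serMatMul_upperPart_apply
      (fun i k => BTL.DressingPair.sqEigMatrix_Psi₂_apply hD i k m n) D.W₂ i j)).trans ?_
    simp [BTL.DressingPair.addFlowY, BTL.pairMul, BTL.minusPart, BTL.upperPart_zero,
      BTL.neg_matMul, BTL.DressingPair.W]
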